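/- Let $\Omega$ be a Polish space. Let $C_b(\Omega)$ be the Banach space of bounded continuous functions $f:\Omega\to\mathbb R$ with the supremum norm, and let $\tau_c$ be the compact-open topology on it. Let $\mathcal M(\Omega)$ be the Banach space of bounded (finite signed) Baire measures on $\Omega$ (equivalently, Borel measures, as $\Omega$ is Polish) with the total variation norm, and let $\tau^\odot=\sigma(\mathcal M(\Omega),C_b(\Omega))$ be the coarsest topology on it for which all the maps $\mu\mapsto\int_\Omega f\,d\mu$, $f\in C_b(\Omega)$, are continuous. For a Banach space $X$ with an additional locally convex topology $\tau$, a family $(T(t))_{t\ge 0}$ of norm-bounded linear operators on $X$ with $T(0)=I$ and $T(s+t)=T(s)T(t)$ for all $s,t\ge 0$ is called a $\tau$-bi-continuous semigroup if 1. $t\mapsto T(t)x$ is $\tau$-continuous on $[0,\infty)$ for every $x\in X$; 2. $\sup_{t\in[0,1]}\|T(t)\|<\infty$; 3. for every norm-bounded sequence $(x_n)$ with $x_n\to 0$ in $\tau$ and every $t_0\ge 0$, $T(t)x_n\to 0$ in $\tau$ uniformly for $t\in[0,t_0]$. **Theorem.** Let $(S(t))_{t\ge 0}$ be a $\tau^\odot$-bi-continuous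 semigroup on $\mathcal M(\Omega)$. Then there is a $\tau_c$-bi-continuous semigroup $(T(t))_{t\ge 0}$ on $C_b(\Omega)$ with $T(t)'|_{\mathcal M(\Omega)}=S(t)$ for all $t\ge 0$, where $T(t)'$ is the Banach space adjoint and measures are regarded as functionals $f\mapsto\int_\Omega f\,d\mu$ on $C_b(\Omega)$; that is, $$\int_\Omega T(t)f\,d\mu=\int_\Omega f\,d(S(t)\mu)\qquad(t\ge 0,\ f\in C_b(\Omega),\ \mu\in\mathcal M(\Omega)).$$ Moreover, this semigroup is given by $$(T(t)f)(x)=\int_\Omega f\,d(S(t)\delta_x)\qquad(t\ge 0,\ f\in C_b(\Omega),\ x\in\Omega),$$ where $\delta_x$ is the Dirac measure at $x$. -/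

import Mathlib

open MeasureTheory Filter Topology
open scoped NNReal ENNReal BoundedContinuousFunction

/-! ### Bi-continuous semigroups -/

/-- `T` is a one-parameter semigroup of bounded linear operators on the normed space `X`. The time
set `[0, ∞)` is `ℝ≥0`. -/
structure IsOperatorSemigroup {X : Type*} [NormedAddCommGroup X] [NormedSpace ℝ X]
    (T : ℝ≥0 → X →L[ℝ] X) : Prop where
  zero : T 0 = ContinuousLinearMap.id ℝ X
  add : ∀ s t : ℝ≥0, T (s + t) = (T s).comp (T t)

/-- `T` is a `τ`-bi-continuous semigroup on the normed space `X`, where `τ` is an additional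
(locally convex) topology on `X`. The operators `T t` are bounded for the norm. -/
structure IsBicontinuousSemigroup {X : Type*} [NormedAddCommGroup X] [NormedSpace ℝ X]
    (T : ℝ≥0 → X →L[ℝ] X) (τ : TopologicalSpace X) : Prop extends IsOperatorSemigroup T where
  /-- Every orbit is `τ`-continuous on `[0, ∞)`. -/
  orbit_continuous : ∀ x : X, Continuous[inferInstance, τ] (fun t : ℝ≥0 => T t x)
  /-- `T` is norm-bounded on `[0, 1]`. -/
  norm_bounded : ∃ M : ℝ, ∀ t : ℝ≥0, t ≤ 1 → ‖T t‖ ≤ M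
  /-- Local bi-equicontinuity: for a norm-bounded `τ`-null sequence `x`, the convergence
  `T(t) xₙ → 0` holds in `τ`, uniformly for `t` in compact intervals `[0, t₀]`. -/
  locally_biequicontinuous : ∀ x : ℕ → X, (∃ C : ℝ, ∀ n, ‖x n‖ ≤ C) →
    Tendsto x atTop (@nhds X τ 0) →
    ∀ t₀ : ℝ≥0, ∀ U ∈ @nhds X τ 0, ∀ᶠ n in atTop, ∀ t : ℝ≥0, t ≤ t₀ → T t (x n) ∈ U

/-! ### The compact-open topology on `Cb(Ω)` -/

/-- The compact-open topology `τ_c` on the space of bounded continuous real functions: the topology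
inherited from `C(Ω, ℝ)`, which Mathlib equips with the compact-open topology. -/
abbrev compactOpenTopology (Ω : Type*) [TopologicalSpace Ω] : TopologicalSpace (Ω →ᵇ ℝ) :=
  TopologicalSpace.induced (fun f : Ω →ᵇ ℝ => f.toContinuousMap) inferInstance

/-! ### The Banach space of bounded (finite signed) measures

The norm is the total variation norm `‖μ‖ = |μ|(Ω)`. -/

section Norm

variable {Ω : Type*} [MeasurableSpace Ω]

instance isFiniteMeasure_variation_signedMeasure (μ : SignedMeasure Ω) :
    IsFiniteMeasure μ.variation := by
  rw [← SignedMeasure.totalVariation_eq_variation]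
  infer_instance

noncomputable instance signedMeasureNormedAddCommGroup :
    NormedAddCommGroup (SignedMeasure Ω) :=
  AddGroupNorm.toNormedAddCommGroup
    { toFun := fun μ => μ.variation.real Set.univ
      map_zero' := by simp
      add_le' := fun μ ν => by
        rw [← measureReal_add_apply]
        exact ENNReal.toReal_mono (measure_ne_top _ _)
          (VectorMeasure.variation_add_le Set.univ)
      neg' := fun μ => by simp
      eq_zero_of_map_eq_zero' := fun μ h => by
        rw [measureReal_eq_zero_iff, Measure.measure_univ_eq_zero,
          VectorMeasure.variation_eq_zero] at h
        exact h }

theorem signedMeasure_norm_def (μ : SignedMeasure Ω) : ‖μ‖ = μ.variation.real Set.univ := rfl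

noncomputable instance signedMeasureNormedSpace : NormedSpace ℝ (SignedMeasure Ω) where
  norm_smul_le c μ := by
    rw [signedMeasure_norm_def, signedMeasure_norm_def, VectorMeasure.variation_smul]
    simp [Measure.real]

end Norm

/-! ### Measures as functionals on `Cb(Ω)` -/

section Pairing

variable {Ω : Type*} [TopologicalSpace Ω] [MeasurableSpace Ω] [OpensMeasurableSpace Ω]

theorem boundedContinuous_integrable (μ : SignedMeasure Ω) (f : Ω →ᵇ ℝ) :
    VectorMeasure.Integrable μ f :=
  f.integrable μ.variation

/-- The canonical map from bounded measures into the norm dual of `Cb(Ω)`,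
`μ ↦ (f ↦ ∫ f dμ)`. -/
noncomputable def measureToDual (Ω : Type*) [TopologicalSpace Ω] [MeasurableSpace Ω]
    [OpensMeasurableSpace Ω] : SignedMeasure Ω →L[ℝ] StrongDual ℝ (Ω →ᵇ ℝ) :=
  LinearMap.mkContinuous₂
    (LinearMap.mk₂ ℝ (fun (μ : SignedMeasure Ω) (f : Ω →ᵇ ℝ) => ∫ᵛ x, f x ∂•μ)
      (fun μ ν f => VectorMeasure.integral_add_vectorMeasure
        (boundedContinuous_integrable μ f) (boundedContinuous_integrable ν f))
      (fun c μ f => VectorMeasure.integral_smul_vectorMeasure f c)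
      (fun μ f g => VectorMeasure.integral_add
        (boundedContinuous_integrable μ f) (boundedContinuous_integrable μ g))
      (fun c μ f => VectorMeasure.integral_smul _ _ _ c)) 1
    (fun μ f => by
      have h := VectorMeasure.norm_integral_le_of_norm_le_const (μ := μ)
        (B := ContinuousLinearMap.lsmul ℝ ℝ) (f := f) (C := ‖f‖)
        (Eventually.of_forall f.norm_coe_le_norm)
      have hB : ‖(ContinuousLinearMap.lsmul ℝ ℝ : ℝ →L[ℝ] ℝ →L[ℝ] ℝ)‖ ≤ 1 :=
        ContinuousLinearMap.opNorm_lsmul_le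
      rw [LinearMap.mk₂_apply, signedMeasure_norm_def]
      refine h.trans ?_
      calc ‖f‖ * ‖(ContinuousLinearMap.lsmul ℝ ℝ : ℝ →L[ℝ] ℝ →L[ℝ] ℝ)‖ * μ.variation.real Set.univ
          ≤ ‖f‖ * 1 * μ.variation.real Set.univ := by gcongr
        _ = 1 * μ.variation.real Set.univ * ‖f‖ := by ring)

@[simp]
theorem measureToDual_apply (μ : SignedMeasure Ω) (f : Ω →ᵇ ℝ) :
    measureToDual Ω μ f = ∫ᵛ x, f x ∂•μ := rfl

/-- The weak topology `σ(M(Ω), Cb(Ω))` on the space of bounded measures: the coarsest topology that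
makes `μ ↦ ∫ f dμ` continuous for every `f ∈ Cb(Ω)`. -/
noncomputable abbrev weakMeasureTopology (Ω : Type*) [TopologicalSpace Ω] [MeasurableSpace Ω] :
    TopologicalSpace (SignedMeasure Ω) :=
  TopologicalSpace.induced (fun (μ : SignedMeasure Ω) (f : Ω →ᵇ ℝ) => ∫ᵛ x, f x ∂•μ) inferInstance

end Pairing

/-! Testing against Dirac measures forces `T(t)f(x) = ∫ f d(S(t)δ_x)`. Bi-equicontinuity of `S`,
applied to the bounded weakly null sequences `δ_{xₙ} - δ_x`, makes this jointly continuous in `(t,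
x)`; so `T(t)f` is continuous and its orbit is `τ_c`-continuous. Duality is linearity on finitely
supported measures, and every measure is the weak limit of a bounded sequence of those
(`measureToDual_apply_eq_of_dirac`).

The hard point is bi-equicontinuity of `T`: for bounded `fₙ → 0` in `τ_c`, `tₙ ≤ t₀` and `xₙ` in a
compact set, the integrals `∫ fₙ d(S(tₙ)δ_{xₙ})` must tend to zero. Along a subsequence the measures
converge weakly to some `ν`, and dominated convergence handles `∫ fₙ dν`. The differences are
bounded and weakly null, and `exists_abs_measureToDual_lt` handles them by a gliding hump: otherwise
one bounded continuous function would keep its integrals against a subsequence away from zero. -/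

/-- The soft threshold of a bounded continuous function. -/
theorem exists_softThreshold {Ω : Type*} [TopologicalSpace Ω] (f : Ω →ᵇ ℝ)
    {δ : ℝ} (hδ : 0 ≤ δ) :
    ∃ g : Ω →ᵇ ℝ, (∀ x, |g x| ≤ |f x|) ∧ (∀ x, |f x - g x| ≤ δ) ∧
      ∀ x, |f x| ≤ δ → g x = 0 := by
  refine ⟨f - (f ⊓ BoundedContinuousFunction.const Ω δ) ⊔ BoundedContinuousFunction.const Ω (-δ),
    fun x => ?_, fun x => ?_, fun x hx => ?_⟩
  all_goals
    simp only [BoundedContinuousFunction.sub_apply, BoundedContinuousFunction.coe_sup,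
      BoundedContinuousFunction.coe_inf, Pi.sup_apply, Pi.inf_apply, BoundedContinuousFunction.const_apply]
    grind

/-! ### Gliding hump for weakly null sequences of measures. -/

section GlidingHump

variable {Ω : Type*} [TopologicalSpace Ω] [MeasurableSpace Ω] [OpensMeasurableSpace Ω]

theorem abs_measureToDual_le_of_support_subset (μ : SignedMeasure Ω) (f : Ω →ᵇ ℝ) {C : ℝ}
    {E : Set Ω} (hE : MeasurableSet E) (hC : ∀ x, |f x| ≤ C) (h0 : ∀ x ∉ E, f x = 0) :
    |measureToDual Ω μ f| ≤ C * μ.variation.real E := by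
  have h := VectorMeasure.norm_integral_le_integral_norm (μ := μ)
    (B := ContinuousLinearMap.lsmul ℝ ℝ) (f := f)
  have hB : ‖(ContinuousLinearMap.lsmul ℝ ℝ : ℝ →L[ℝ] ℝ →L[ℝ] ℝ)‖ ≤ 1 :=
    ContinuousLinearMap.opNorm_lsmul_le
  have hint : 0 ≤ ∫ x, ‖f x‖ ∂μ.variation := integral_nonneg fun _ => norm_nonneg _
  rw [← Real.norm_eq_abs, measureToDual_apply]
  calc _ ≤ _ := h
    _ ≤ 1 * ∫ x, ‖f x‖ ∂μ.variation := by gcongr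
    _ = ∫ x, ‖f x‖ ∂μ.variation := one_mul _
    _ ≤ ∫ x, E.indicator (fun _ => C) x ∂μ.variation := by
        refine integral_mono (f.integrable μ.variation).norm
          ((integrable_const C).indicator hE) fun x => ?_
        by_cases hx : x ∈ E
        · simpa [hx] using hC x
        · simp [hx, h0 x hx]
    _ = C * μ.variation.real E := by
        rw [integral_indicator_const _ hE, smul_eq_mul, mul_comm]

theorem abs_measureToDual_le (μ : SignedMeasure Ω) (f : Ω →ᵇ ℝ) {C : ℝ}
    (hC : ∀ x, |f x| ≤ C) : |measureToDual Ω μ f| ≤ C * ‖μ‖ :=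
  abs_measureToDual_le_of_support_subset μ f MeasurableSet.univ hC (by simp)

/-- Modifying `Ψ` where `h` does not vanish, one can make the integral as large as that of `h`. -/
theorem exists_perturbation_le_abs_measureToDual (μ : SignedMeasure Ω) (h Ψ : Ω →ᵇ ℝ) {ε : ℝ}
    (hh : ∀ x, |h x| ≤ 1) (hε : ε ≤ |measureToDual Ω μ h|) :
    ∃ Ψ' : Ω →ᵇ ℝ, (∀ x, |Ψ x| ≤ 1 → |Ψ' x| ≤ 1) ∧ (∀ x, h x = 0 → Ψ' x = Ψ x) ∧
      ε ≤ |measureToDual Ω μ Ψ'| := by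
  -- Damping `Ψ` by `1 - |h|` leaves room to add `±h` within the bound 1. The two integrals differ
  -- by `2 ∫ h dμ`, so one of the signs works.
  set A : Ω →ᵇ ℝ := Ψ - |h| * Ψ with hA
  have hAx : ∀ x, A x = (1 - |h x|) * Ψ x := fun x => by
    simp only [hA, BoundedContinuousFunction.sub_apply, BoundedContinuousFunction.mul_apply,
      BoundedContinuousFunction.coe_abs, Pi.abs_apply]
    ring
  have hAle : ∀ x, |Ψ x| ≤ 1 → |A x| ≤ 1 - |h x| := fun x hx => by
    rw [hAx, abs_mul, abs_of_nonneg (sub_nonneg.2 (hh x))]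
    exact mul_le_of_le_one_right (sub_nonneg.2 (hh x)) hx
  clear_value A
  have key : ε ≤ |measureToDual Ω μ (A + h)| ∨ ε ≤ |measureToDual Ω μ (A - h)| := by
    by_contra! hcon
    have h2 : measureToDual Ω μ (A + h) - measureToDual Ω μ (A - h)
        = 2 * measureToDual Ω μ h := by
      rw [map_add, map_sub]; ring
    have h3 := abs_sub (measureToDual Ω μ (A + h)) (measureToDual Ω μ (A - h))
    rw [h2, abs_mul, abs_two] at h3
    linarith [hcon.1, hcon.2]
  rcases key with hk | hk
  · refine ⟨A + h, fun x hx => ?_, fun x hx => ?_, hk⟩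
    · rw [BoundedContinuousFunction.add_apply]
      linarith [abs_add_le (A x) (h x), hAle x hx]
    · simp [hAx, hx]
  · refine ⟨A - h, fun x hx => ?_, fun x hx => ?_, hk⟩
    · rw [BoundedContinuousFunction.sub_apply]
      linarith [abs_sub (A x) (h x), hAle x hx]
    · simp [hAx, hx]

/-- Gliding hump: a single test function detects all the `μ k` at once. -/
theorem exists_forall_le_abs_measureToDual (μ : ℕ → SignedMeasure Ω) (h : ℕ → Ω →ᵇ ℝ) {ε : ℝ}
    (hh : ∀ n x, |h n x| ≤ 1) (hε : ∀ n, ε ≤ |measureToDual Ω (μ n) (h n)|)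
    (hloc : ∀ x, ∃ V ∈ 𝓝 x, ∃ N, ∀ n ≥ N, ∀ y ∈ V, h n y = 0)
    (htail : ∀ k, (μ k).variation.real {x | ∃ n > k, h n x ≠ 0} ≤ ε / 4) :
    ∃ Φ : Ω →ᵇ ℝ, ∀ k, ε / 2 ≤ |measureToDual Ω (μ k) Φ| := by
  choose P hP1 hP2 hP3 using fun (k : ℕ) (Ψ : Ω →ᵇ ℝ) =>
    exists_perturbation_le_abs_measureToDual (μ k) (h k) Ψ (hh k) (hε k)
  let Ψ : ℕ → Ω →ᵇ ℝ := fun k => Nat.rec 0 (fun k φ => P k φ) k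
  have hΨs : ∀ k, Ψ (k + 1) = P k (Ψ k) := fun _ => rfl
  have hΨle : ∀ k x, |Ψ k x| ≤ 1 := by
    intro k x
    induction k with
    | zero => simp [Ψ]
    | succ k ih => exact hP1 k _ x ih
  have hΨeq : ∀ x j, (∀ n ≥ j, h n x = 0) → ∀ n ≥ j, Ψ n x = Ψ j x := by
    intro x j hj n hn
    induction n, hn using Nat.le_induction with
    | base => rfl
    | succ n hn ih => rw [hΨs, hP2 n _ x (hj n hn), ih]
  choose V hV N hN using hloc
  have hN' : ∀ x, ∀ n ≥ N x, h n x = 0 := fun x n hn => hN x n hn x (mem_of_mem_nhds (hV x))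
  have hF : ∀ x j, (∀ n ≥ j, h n x = 0) → Ψ (N x) x = Ψ j x := by
    intro x j hj
    rw [← hΨeq x j hj (max j (N x)) (le_max_left _ _),
      ← hΨeq x (N x) (hN' x) (max j (N x)) (le_max_right _ _)]
  -- Near `x` all humps from `N x` on vanish, so the limit coincides there with the single function
  -- `Ψ (N x)`.
  have hcont : Continuous fun x => Ψ (N x) x := by
    refine continuous_iff_continuousAt.2 fun x => ?_
    refine (Ψ (N x)).continuous.continuousAt.congr ?_
    filter_upwards [hV x] with y hy
    exact (hF y (N x) fun n hn => hN x n hn y hy).symm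
  let Φ : Ω →ᵇ ℝ := BoundedContinuousFunction.ofNormedAddCommGroup (fun x => Ψ (N x) x) hcont 1
    fun x => hΨle _ x
  have hΦ : ∀ x, Φ x = Ψ (N x) x := fun _ => rfl
  have hΦle : ∀ x, |Φ x| ≤ 1 := fun x => hΨle _ x
  refine ⟨Φ, fun k => ?_⟩
  have hmeas : MeasurableSet {x | ∃ n > k, h n x ≠ 0} := by
    have : IsOpen {x | ∃ n > k, h n x ≠ 0} := by
      simp only [Set.ofPred_exists, Set.ofPred_and]
      refine isOpen_iUnion fun n => isOpen_const.inter ?_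
      exact isOpen_ne_fun (h n).continuous continuous_const
    exact this.measurableSet
  -- Humps after `k` change `Ψ (k + 1)` by at most 2, on a set of mass at most `ε / 4`: half of `ε`
  -- survives.
  have hb := abs_measureToDual_le_of_support_subset (μ k) (Φ - Ψ (k + 1)) (C := 2) hmeas
    (fun x => by
      rw [BoundedContinuousFunction.sub_apply]
      linarith [abs_sub (Φ x) (Ψ (k + 1) x), hΨle (k + 1) x, hΦle x])
    (fun x hx => by
      rw [BoundedContinuousFunction.sub_apply, hΦ, sub_eq_zero]
      refine hF x (k + 1) fun n hn => ?_
      by_contra hne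
      exact hx ⟨n, hn, hne⟩)
  rw [map_sub] at hb
  have h1 := hP3 k (Ψ k)
  rw [← hΨs] at h1
  have h2 := abs_sub_abs_le_abs_sub (measureToDual Ω (μ k) (Ψ (k + 1))) (measureToDual Ω (μ k) Φ)
  rw [abs_sub_comm] at h2
  linarith [htail k]

/-- A bounded weakly null sequence of measures and a bounded, locally uniformly null sequence of
functions: the integrals do not stay away from zero. -/
theorem exists_abs_measureToDual_lt (μ : ℕ → SignedMeasure Ω) (f : ℕ → Ω →ᵇ ℝ) {M C ε : ℝ}
    (hM : ∀ n, ‖μ n‖ ≤ M) (hC : ∀ n, ‖f n‖ ≤ C)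
    (hμ : ∀ g : Ω →ᵇ ℝ, Tendsto (fun n => measureToDual Ω (μ n) g) atTop (𝓝 0))
    (hf : ∀ δ > 0, ∀ x, ∃ V ∈ 𝓝 x, ∀ᶠ n in atTop, ∀ y ∈ V, |f n y| < δ) (hε : 0 < ε) :
    ∃ n, |measureToDual Ω (μ n) (f n)| < ε := by
  by_contra! hcon
  have hM0 : 0 ≤ M := (norm_nonneg _).trans (hM 0)
  have hC0 : 0 ≤ C := (norm_nonneg _).trans (hC 0)
  -- Thresholding at `δ` costs at most `δ * M ≤ ε / 2` in each integral, and makes the functions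
  -- locally eventually zero.
  set δ := ε / (2 * (M + 1)) with hδ
  have hδ0 : 0 < δ := by positivity
  have hδM : δ * M ≤ ε / 2 := by
    rw [hδ, div_mul_eq_mul_div, div_le_div_iff₀ (by positivity) (by positivity)]
    nlinarith
  choose g hg1 hg2 hg3 using fun n => exists_softThreshold (f n) hδ0.le
  set h : ℕ → Ω →ᵇ ℝ := fun n => (C + 1)⁻¹ • g n with hh
  have hh0 : ∀ n x, |f n x| ≤ δ → h n x = 0 := fun n x hx => by
    simp [hh, hg3 n x hx]
  have hh1 : ∀ n x, |h n x| ≤ 1 := fun n x => by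
    have : |g n x| ≤ C + 1 := by
      have := (f n).norm_coe_le_norm x
      rw [Real.norm_eq_abs] at this
      linarith [hg1 n x, hC n]
    rw [hh, BoundedContinuousFunction.smul_apply, smul_eq_mul, abs_mul,
      abs_of_pos (by positivity : 0 < (C + 1)⁻¹), inv_mul_le_iff₀ (by positivity)]
    linarith
  set η := (C + 1)⁻¹ * (ε / 2) with hη
  have hη0 : 0 < η := by positivity
  have hhη : ∀ n, η ≤ |measureToDual Ω (μ n) (h n)| := fun n => by
    rw [hh, map_smul, smul_eq_mul, abs_mul, abs_of_pos (by positivity : 0 < (C + 1)⁻¹), hη]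
    refine mul_le_mul_of_nonneg_left ?_ (by positivity)
    have h1 := abs_measureToDual_le (μ n) (f n - g n) (C := δ) (fun x => by simpa using hg2 n x)
    rw [map_sub] at h1
    have h2 := abs_sub_abs_le_abs_sub (measureToDual Ω (μ n) (f n)) (measureToDual Ω (μ n) (g n))
    have h3 : δ * ‖μ n‖ ≤ δ * M := mul_le_mul_of_nonneg_left (hM n) hδ0.le
    linarith [hcon n]
  have hloc : ∀ x, ∃ V ∈ 𝓝 x, ∃ N, ∀ n ≥ N, ∀ y ∈ V, h n y = 0 := fun x => by
    obtain ⟨V, hV, hN⟩ := hf δ hδ0 x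
    obtain ⟨N, hN⟩ := eventually_atTop.1 hN
    exact ⟨V, hV, N, fun n hn y hy => hh0 n y (hN n hn y hy).le⟩
  set E : ℕ → Set Ω := fun n => {x | ∃ m ≥ n, h m x ≠ 0} with hE
  have hEmeas : ∀ n, MeasurableSet (E n) := fun n => by
    have : IsOpen (E n) := by
      simp only [hE, Set.ofPred_exists, Set.ofPred_and]
      exact isOpen_iUnion fun m => isOpen_const.inter
        (isOpen_ne_fun (h m).continuous continuous_const)
    exact this.measurableSet
  have hEanti : Antitone E := fun a b hab x ⟨m, hm, hx⟩ => ⟨m, hab.trans hm, hx⟩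
  have hEempty : ⋂ n, E n = ∅ := by
    refine Set.eq_empty_of_forall_notMem fun x hx => ?_
    obtain ⟨V, hV, N, hN⟩ := hloc x
    obtain ⟨m, hm, hne⟩ := Set.mem_iInter.1 hx N
    exact hne (hN m hm x (mem_of_mem_nhds hV))
  have hsmall : ∀ k, ∃ N > k, (μ k).variation.real (E N) ≤ η / 4 := fun k => by
    have h1 := tendsto_measure_iInter_atTop (μ := (μ k).variation)
      (fun n => (hEmeas n).nullMeasurableSet) hEanti ⟨0, measure_ne_top _ _⟩
    rw [hEempty, measure_empty] at h1
    have h2 := (ENNReal.tendsto_toReal ENNReal.zero_ne_top).comp h1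
    have h3 := h2.eventually (Iio_mem_nhds
      (show (0 : ℝ≥0∞).toReal < η / 4 by simpa using by positivity))
    obtain ⟨N, hN, hkN⟩ := (h3.and (eventually_gt_atTop k)).exists
    exact ⟨N, hkN, le_of_lt hN⟩
  choose N hN1 hN2 using hsmall
  -- All humps after the `k`-th live in `E (φ (k + 1)) = E (N (φ k))`, which is negligible for `μ (φ
  -- k)`.
  let φ : ℕ → ℕ := fun k => Nat.rec 0 (fun _ m => N m) k
  have hφ : StrictMono φ := strictMono_nat_of_lt_succ fun k => hN1 (φ k)
  obtain ⟨Φ, hΦ⟩ := exists_forall_le_abs_measureToDual (fun k => μ (φ k)) (fun k => h (φ k))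
    (fun k => hh1 (φ k)) (fun k => hhη (φ k))
    (fun x => by
      obtain ⟨V, hV, N, hN⟩ := hloc x
      exact ⟨V, hV, N, fun n hn y hy => hN _ (hn.le.trans (hφ.id_le n)) y hy⟩)
    (fun k => by
      refine le_trans (measureReal_mono ?_) (hN2 (φ k))
      rintro x ⟨n, hn, hx⟩
      exact ⟨φ n, hφ.monotone (Nat.succ_le_of_lt hn), hx⟩)
  have hlim := ((hμ Φ).comp hφ.tendsto_atTop).abs
  rw [abs_zero] at hlim
  have := ge_of_tendsto' hlim hΦ
  linarith

end GlidingHump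

/-! ### Approximation by finitely supported measures. -/

section Approximation

theorem SignedMeasure.map_simpleFunc_eq_sum {Ω : Type*} [MeasurableSpace Ω]
    [MeasurableSingletonClass Ω] (μ : SignedMeasure Ω) (φ : SimpleFunc Ω Ω) :
    μ.map φ = ∑ y ∈ φ.range, μ (φ ⁻¹' {y}) • (VectorMeasure.dirac y 1 : SignedMeasure Ω) := by
  classical
  ext s hs
  rw [VectorMeasure.map_apply _ φ.measurable hs]
  have hset : φ ⁻¹' s = ⋃ y ∈ φ.range.filter (· ∈ s), φ ⁻¹' {y} := by
    ext x
    simp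
  rw [hset, VectorMeasure.of_biUnion_finset
    (fun y _ z _ hyz => Disjoint.preimage _ (Set.disjoint_singleton.2 hyz))
    (fun y _ => φ.measurable (measurableSet_singleton y)), Finset.sum_filter]
  have hsum : ∀ A : Finset Ω, (∑ y ∈ A, μ (φ ⁻¹' {y}) •
      (VectorMeasure.dirac y 1 : SignedMeasure Ω)) s =
      ∑ y ∈ A, (μ (φ ⁻¹' {y}) • (VectorMeasure.dirac y 1 : SignedMeasure Ω)) s := fun A => by
    induction A using Finset.induction_on with
    | empty => simp
    | insert a A ha ih => rw [Finset.sum_insert ha, Finset.sum_insert ha, ← ih]; rfl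
  rw [hsum]
  refine Finset.sum_congr rfl fun y _ => ?_
  by_cases hy : y ∈ s <;> simp [hy, hs]

variable {Ω : Type*} [MeasurableSpace Ω]

theorem norm_dirac_one (x : Ω) : ‖(VectorMeasure.dirac x 1 : SignedMeasure Ω)‖ = 1 := by
  rw [signedMeasure_norm_def, VectorMeasure.variation_dirac]
  simp

/-- Keeps the approximating measures norm-bounded, as bi-equicontinuity requires. -/
theorem norm_map_le (μ : SignedMeasure Ω) {φ : Ω → Ω} (hφ : Measurable φ) :
    ‖μ.map φ‖ ≤ ‖μ‖ := by
  rw [signedMeasure_norm_def, signedMeasure_norm_def]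
  have h := VectorMeasure.variation_map_le (μ := μ) (φ := φ) Set.univ
  rw [Measure.map_apply hφ MeasurableSet.univ, Set.preimage_univ] at h
  exact ENNReal.toReal_mono (measure_ne_top _ _) h

/-- Finitely supported measures are weakly sequentially dense. -/
theorem exists_simpleFunc_tendsto_measureToDual_map [TopologicalSpace Ω] [PolishSpace Ω] [BorelSpace Ω]
    [Nonempty Ω] (μ : SignedMeasure Ω) :
    ∃ φ : ℕ → SimpleFunc Ω Ω, ∀ f : Ω →ᵇ ℝ,
      Tendsto (fun n => measureToDual Ω (μ.map (φ n)) f) atTop (𝓝 (measureToDual Ω μ f)) := by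
  let := TopologicalSpace.upgradeIsCompletelyMetrizable Ω
  obtain ⟨y₀⟩ := ‹Nonempty Ω›
  refine ⟨SimpleFunc.approxOn id measurable_id Set.univ y₀ (Set.mem_univ _), fun f => ?_⟩
  set φ := SimpleFunc.approxOn (id : Ω → Ω) measurable_id Set.univ y₀ (Set.mem_univ _)
  have hfm : StronglyMeasurable f := f.continuous.stronglyMeasurable
  have heq : ∀ n, measureToDual Ω (μ.map (φ n)) f = ∫ᵛ x, f (φ n x) ∂•μ := fun n => by
    rw [measureToDual_apply]
    refine VectorMeasure.integral_map (φ n).measurable hfm.aestronglyMeasurable ?_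
    refine Integrable.of_bound (C := ‖f‖)
      (hfm.comp_measurable (φ n).measurable).aestronglyMeasurable ?_
    exact Eventually.of_forall fun x => f.norm_coe_le_norm _
  simp_rw [heq, measureToDual_apply]
  refine VectorMeasure.tendsto_integral_filter_of_norm_le_const
    (Eventually.of_forall fun n => (hfm.comp_measurable (φ n).measurable).aestronglyMeasurable)
    ⟨‖f‖, Eventually.of_forall fun n => Eventually.of_forall fun x => f.norm_coe_le_norm _⟩
    (Eventually.of_forall fun x => ?_)
  exact (f.continuous.tendsto x).comp
    (SimpleFunc.tendsto_approxOn measurable_id (Set.mem_univ _) (by simp))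

end Approximation

/-! ### Convergence in the weak and compact-open topologies. -/

section Topologies

variable {Ω : Type*} [TopologicalSpace Ω]

theorem tendsto_weakMeasureTopology_iff [MeasurableSpace Ω] [OpensMeasurableSpace Ω] {ι : Type*}
    {l : Filter ι} {u : ι → SignedMeasure Ω} {μ : SignedMeasure Ω} :
    Tendsto u l (@nhds _ (weakMeasureTopology Ω) μ) ↔
      ∀ f : Ω →ᵇ ℝ, Tendsto (fun i => measureToDual Ω (u i) f) l (𝓝 (measureToDual Ω μ f)) := by
  rw [nhds_induced, tendsto_comap_iff, tendsto_pi_nhds]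
  rfl

theorem setOf_abs_measureToDual_lt_mem_nhds [MeasurableSpace Ω] [OpensMeasurableSpace Ω]
    (f : Ω →ᵇ ℝ) {ε : ℝ} (hε : 0 < ε) :
    {μ | |measureToDual Ω μ f| < ε} ∈ @nhds _ (weakMeasureTopology Ω) 0 := by
  have h := tendsto_weakMeasureTopology_iff.1
    (tendsto_id (x := @nhds _ (weakMeasureTopology Ω) (0 : SignedMeasure Ω))) f
  have h' := h.abs
  simp only [map_zero, zero_apply, abs_zero] at h'
  exact h'.eventually (Iio_mem_nhds hε)

theorem tendsto_compactOpenTopology_iff {ι : Type*} {l : Filter ι} {u : ι → Ω →ᵇ ℝ}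
    {f : Ω →ᵇ ℝ} :
    Tendsto u l (@nhds _ (compactOpenTopology Ω) f) ↔
      ∀ K, IsCompact K → TendstoUniformlyOn (fun i => u i) f l K := by
  rw [nhds_induced, tendsto_comap_iff, ContinuousMap.tendsto_iff_forall_isCompact_tendstoUniformlyOn]
  rfl

theorem exists_isCompact_of_mem_nhds_compactOpenTopology {U : Set (Ω →ᵇ ℝ)}
    (hU : U ∈ @nhds _ (compactOpenTopology Ω) 0) :
    ∃ K, IsCompact K ∧ ∃ ε > 0, ∀ f : Ω →ᵇ ℝ, (∀ x ∈ K, |f x| < ε) → f ∈ U := by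
  rw [nhds_induced] at hU
  obtain ⟨W, hW, hWU⟩ := hU
  obtain ⟨⟨K, ε⟩, ⟨hK, hε⟩, hKε⟩ :=
    ((Metric.nhds_basis_ball (x := (0 : ℝ))).nhds_continuousMapConst (X := Ω)).mem_iff.1 hW
  exact ⟨K, hK, ε, hε, fun f hf => hWU (hKε fun x hx => by simpa using! hf x hx)⟩

/-- In a first countable space, uniform convergence on compact sets is locally uniform. -/
theorem exists_nhds_eventually_abs_lt [FirstCountableTopology Ω] {f : ℕ → Ω →ᵇ ℝ}
    (hf : Tendsto f atTop (@nhds _ (compactOpenTopology Ω) 0)) {δ : ℝ} (hδ : 0 < δ) (x : Ω) :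
    ∃ V ∈ 𝓝 x, ∀ᶠ n in atTop, ∀ y ∈ V, |f n y| < δ := by
  rw [tendsto_compactOpenTopology_iff] at hf
  by_contra! hcon
  obtain ⟨V, hV⟩ := (𝓝 x).exists_antitone_basis
  have h1 : ∀ k, ∃ n ≥ k, ∃ y ∈ V k, δ ≤ |f n y| := fun k => by
    obtain ⟨n, hn, hn'⟩ := frequently_atTop.1 (hcon (V k) (hV.mem k)) k
    exact ⟨n, hn, hn'⟩
  choose n hn y hy hle using h1
  have hyx : Tendsto y atTop (𝓝 x) := hV.tendsto hy
  -- The bad points `y k` converge to `x`, so together with `x` they form a compact set on which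
  -- convergence is uniform.
  have h2 := Metric.tendstoUniformlyOn_iff.1 (hf _ hyx.isCompact_insert_range) δ hδ
  obtain ⟨N, hN⟩ := eventually_atTop.1 h2
  have h3 := hN (n N) (hn N) (y N) (Set.mem_insert_of_mem _ ⟨N, rfl⟩)
  rw [dist_comm, Real.dist_eq] at h3
  have h4 := hle N
  simp at h3
  linarith

end Topologies

theorem IsBicontinuousSemigroup.exists_norm_le {X : Type*} [NormedAddCommGroup X]
    [NormedSpace ℝ X] {T : ℝ≥0 → X →L[ℝ] X} {τ : TopologicalSpace X}
    (hT : IsBicontinuousSemigroup T τ) (t₀ : ℝ≥0) :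
    ∃ M : ℝ, 0 ≤ M ∧ ∀ t ≤ t₀, ‖T t‖ ≤ M := by
  obtain ⟨M, hM⟩ := hT.norm_bounded
  have key : ∀ n : ℕ, ∃ K : ℝ, ∀ t : ℝ≥0, t ≤ n → ‖T t‖ ≤ K := by
    intro n
    induction n with
    | zero => exact ⟨M, fun t ht => hM t (ht.trans (by simp))⟩
    | succ n ih =>
      obtain ⟨K, hK⟩ := ih
      refine ⟨max K (M * K), fun t ht => ?_⟩
      rcases le_total t n with h | h
      · exact (hK t h).trans (le_max_left _ _)
      · obtain ⟨s, rfl⟩ := exists_add_of_le h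
        rw [add_comm, hT.add]
        have hs : s ≤ 1 := by
          push_cast at ht
          exact le_of_add_le_add_left ht
        refine le_trans ?_ (le_max_right _ _)
        refine (ContinuousLinearMap.opNorm_comp_le _ _).trans ?_
        exact mul_le_mul (hM s hs) (hK n le_rfl) (norm_nonneg _)
          ((norm_nonneg _).trans (hM s hs))
  obtain ⟨n, hn⟩ := exists_nat_ge t₀
  obtain ⟨K, hK⟩ := key n
  exact ⟨K, (norm_nonneg _).trans (hK 0 (by simp)), fun t ht => hK t (ht.trans hn)⟩

/-! ### The pre-adjoint operators and their continuity. -/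

section Semigroup

variable {Ω : Type*} [TopologicalSpace Ω] [MeasurableSpace Ω]
  {S : ℝ≥0 → SignedMeasure Ω →L[ℝ] SignedMeasure Ω}

theorem tendsto_measureToDual_orbit [OpensMeasurableSpace Ω]
    (hS : IsBicontinuousSemigroup S (weakMeasureTopology Ω)) (μ : SignedMeasure Ω) (f : Ω →ᵇ ℝ)
    (t : ℝ≥0) :
    Tendsto (fun s => measureToDual Ω (S s μ) f) (𝓝 t) (𝓝 (measureToDual Ω (S t μ) f)) :=
  tendsto_weakMeasureTopology_iff.1
    (@Continuous.tendsto _ _ _ (weakMeasureTopology Ω) _ (hS.orbit_continuous μ) t) f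

/-- The only form in which bi-equicontinuity of `S` is used. -/
theorem eventually_abs_measureToDual_lt [OpensMeasurableSpace Ω]
    (hS : IsBicontinuousSemigroup S (weakMeasureTopology Ω)) {μ : ℕ → SignedMeasure Ω}
    (hb : ∃ C, ∀ n, ‖μ n‖ ≤ C)
    (hμ : ∀ f : Ω →ᵇ ℝ, Tendsto (fun n => measureToDual Ω (μ n) f) atTop (𝓝 0)) (t₀ : ℝ≥0)
    (f : Ω →ᵇ ℝ) {ε : ℝ} (hε : 0 < ε) :
    ∀ᶠ n in atTop, ∀ t ≤ t₀, |measureToDual Ω (S t (μ n)) f| < ε :=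
  hS.locally_biequicontinuous μ hb
    (tendsto_weakMeasureTopology_iff.2 fun f => by simpa using hμ f) t₀ _
    (setOf_abs_measureToDual_lt_mem_nhds f hε)

theorem measureToDual_dirac [OpensMeasurableSpace Ω] (x : Ω) (f : Ω →ᵇ ℝ) :
    measureToDual Ω (VectorMeasure.dirac x 1) f = f x := by
  rw [measureToDual_apply,
    VectorMeasure.integral_dirac' f.continuous.measurable.stronglyMeasurable]
  simp

/-- Along convergent sequences of times and points, the measures `S(t)δ_x` converge weakly. -/
theorem tendsto_measureToDual_dirac [OpensMeasurableSpace Ω]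
    (hS : IsBicontinuousSemigroup S (weakMeasureTopology Ω)) {t : ℕ → ℝ≥0} {x : ℕ → Ω} {s : ℝ≥0}
    {y : Ω} (ht : Tendsto t atTop (𝓝 s)) (hx : Tendsto x atTop (𝓝 y)) (f : Ω →ᵇ ℝ) :
    Tendsto (fun n => measureToDual Ω (S (t n) (VectorMeasure.dirac (x n) 1)) f) atTop
      (𝓝 (measureToDual Ω (S s (VectorMeasure.dirac y 1)) f)) := by
  have h1 := (tendsto_measureToDual_orbit hS (VectorMeasure.dirac y 1) f s).comp ht
  have h2 : Tendsto (fun n => measureToDual Ω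
      (S (t n) (VectorMeasure.dirac (x n) 1 - VectorMeasure.dirac y 1)) f) atTop (𝓝 0) := by
    rw [Metric.tendsto_atTop']
    intro ε hε
    have hev := eventually_abs_measureToDual_lt hS
      (μ := fun n => VectorMeasure.dirac (x n) 1 - VectorMeasure.dirac y 1)
      ⟨2, fun n => (norm_sub_le _ _).trans (by
        rw [norm_dirac_one, norm_dirac_one]; norm_num)⟩
      -- The bound `s + 1` on times eventually dominates `t n`.
      (fun g => by
        simp only [map_sub, sub_apply, measureToDual_dirac]
        simpa using ((g.continuous.tendsto y).comp hx).sub_const (g y)) (s + 1) f hε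
    have hts : ∀ᶠ n in atTop, t n ≤ s + 1 :=
      (ht.eventually (Iio_mem_nhds (lt_add_one s))).mono fun n hn => le_of_lt hn
    obtain ⟨N, hN⟩ := eventually_atTop.1 (hev.and hts)
    refine ⟨N, fun n hn => ?_⟩
    obtain ⟨h3, h4⟩ := hN n hn.le
    simpa using h3 (t n) h4
  have h3 := h2.add h1
  simp only [zero_add] at h3
  refine h3.congr fun n => ?_
  simp

theorem continuous_measureToDual_dirac [FirstCountableTopology Ω] [OpensMeasurableSpace Ω]
    (hS : IsBicontinuousSemigroup S (weakMeasureTopology Ω)) (f : Ω →ᵇ ℝ) :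
    Continuous fun p : ℝ≥0 × Ω => measureToDual Ω (S p.1 (VectorMeasure.dirac p.2 1)) f := by
  rw [continuous_iff_seqContinuous]
  intro p q hpq
  exact tendsto_measureToDual_dirac hS ((continuous_fst.tendsto q).comp hpq)
    ((continuous_snd.tendsto q).comp hpq) f

theorem abs_measureToDual_dirac_le [OpensMeasurableSpace Ω]
    (A : SignedMeasure Ω →L[ℝ] SignedMeasure Ω) (f : Ω →ᵇ ℝ) (x : Ω) : |measureToDual Ω (A (VectorMeasure.dirac x 1)) f| ≤ ‖A‖ * ‖f‖ := by
  refine (abs_measureToDual_le _ f fun y => f.norm_coe_le_norm y).trans ?_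
  have h := A.le_opNorm (VectorMeasure.dirac x 1)
  rw [norm_dirac_one, mul_one] at h
  rw [mul_comm]
  exact mul_le_mul_of_nonneg_right h (norm_nonneg f)

/-- The operator `f ↦ (x ↦ ∫ f d(A δ_x))` on bounded continuous functions. -/
noncomputable def preadjoint [OpensMeasurableSpace Ω] (A : SignedMeasure Ω →L[ℝ] SignedMeasure Ω)
    (hA : ∀ f : Ω →ᵇ ℝ,
      Continuous fun x => measureToDual Ω (A (VectorMeasure.dirac x 1)) f) :
    (Ω →ᵇ ℝ) →L[ℝ] (Ω →ᵇ ℝ) :=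
  LinearMap.mkContinuous
    { toFun := fun f => BoundedContinuousFunction.ofNormedAddCommGroup
        (fun x => measureToDual Ω (A (VectorMeasure.dirac x 1)) f) (hA f) (‖A‖ * ‖f‖)
        (abs_measureToDual_dirac_le A f)
      map_add' := fun f g => by
        ext x
        exact map_add (measureToDual Ω (A (VectorMeasure.dirac x 1))) f g
      map_smul' := fun c f => by
        ext x
        exact map_smul (measureToDual Ω (A (VectorMeasure.dirac x 1))) c f }
    ‖A‖ fun f => BoundedContinuousFunction.norm_ofNormedAddCommGroup_le (hA f)
      (mul_nonneg (norm_nonneg _) (norm_nonneg _)) (abs_measureToDual_dirac_le A f)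

theorem preadjoint_apply [OpensMeasurableSpace Ω] (A : SignedMeasure Ω →L[ℝ] SignedMeasure Ω)
    (hA : ∀ f : Ω →ᵇ ℝ,
      Continuous fun x => measureToDual Ω (A (VectorMeasure.dirac x 1)) f) (f : Ω →ᵇ ℝ) (x : Ω) :
    preadjoint A hA f x = measureToDual Ω (A (VectorMeasure.dirac x 1)) f := rfl

theorem norm_preadjoint_le [OpensMeasurableSpace Ω] (A : SignedMeasure Ω →L[ℝ] SignedMeasure Ω)
    (hA : ∀ f : Ω →ᵇ ℝ,
      Continuous fun x => measureToDual Ω (A (VectorMeasure.dirac x 1)) f) :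
    ‖preadjoint A hA‖ ≤ ‖A‖ :=
  LinearMap.mkContinuous_norm_le _ (norm_nonneg _) _

/-- A function `g` with `∫ g dμ = ∫ f d(S(t)μ)` for all Dirac measures `μ` satisfies this for all
measures `μ`. -/
theorem measureToDual_apply_eq_of_dirac [PolishSpace Ω] [BorelSpace Ω]
    (hS : IsBicontinuousSemigroup S (weakMeasureTopology Ω)) (t : ℝ≥0) (f g : Ω →ᵇ ℝ)
    (hg : ∀ x, g x = measureToDual Ω (S t (VectorMeasure.dirac x 1)) f) (μ : SignedMeasure Ω) :
    measureToDual Ω μ g = measureToDual Ω (S t μ) f := by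
  rcases isEmpty_or_nonempty Ω with hΩ | hΩ
  · rw [VectorMeasure.eq_zero_of_isEmpty μ]
    simp
  obtain ⟨φ, hφ⟩ := exists_simpleFunc_tendsto_measureToDual_map μ
  -- The pushforwards are finite combinations of Dirac measures, so linearity suffices.
  have heq : ∀ n, measureToDual Ω (S t (μ.map (φ n))) f = measureToDual Ω (μ.map (φ n)) g := by
    intro n
    rw [SignedMeasure.map_simpleFunc_eq_sum]
    simp only [map_sum, map_smul, sum_apply, smul_apply,
      measureToDual_dirac, hg]
  have h1 : Tendsto (fun n => measureToDual Ω (S t (μ.map (φ n) - μ)) f) atTop (𝓝 0) := by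
    rw [Metric.tendsto_atTop']
    intro ε hε
    have hev := eventually_abs_measureToDual_lt hS (μ := fun n => μ.map (φ n) - μ)
      ⟨‖μ‖ + ‖μ‖, fun n => (norm_sub_le _ _).trans
        (by gcongr; exact norm_map_le μ (φ n).measurable)⟩
      (fun g => by
        simp only [map_sub, sub_apply]
        simpa using (hφ g).sub_const (measureToDual Ω μ g)) t f hε
    obtain ⟨N, hN⟩ := eventually_atTop.1 hev
    exact ⟨N, fun n hn => by simpa using hN n hn.le t le_rfl⟩
  have h2 : Tendsto (fun n => measureToDual Ω (μ.map (φ n)) g) atTop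
      (𝓝 (measureToDual Ω (S t μ) f)) := by
    have h3 := h1.add_const (measureToDual Ω (S t μ) f)
    rw [zero_add] at h3
    refine h3.congr fun n => ?_
    rw [map_sub, map_sub, sub_apply, heq]
    ring
  exact tendsto_nhds_unique (hφ g) h2

/-- For a bounded `τ_c`-null sequence of functions, the integrals with respect to `S(t)δ_x` tend to
zero uniformly in `t ≤ t₀` and `x` in a compact set. -/
theorem eventually_abs_measureToDual_dirac_lt [FirstCountableTopology Ω] [OpensMeasurableSpace Ω]
    (hS : IsBicontinuousSemigroup S (weakMeasureTopology Ω)) {f : ℕ → Ω →ᵇ ℝ}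
    (hb : ∃ C, ∀ n, ‖f n‖ ≤ C) (hf : Tendsto f atTop (@nhds _ (compactOpenTopology Ω) 0))
    (t₀ : ℝ≥0) {K : Set Ω} (hK : IsCompact K) {ε : ℝ} (hε : 0 < ε) :
    ∀ᶠ n in atTop, ∀ t ≤ t₀, ∀ x ∈ K,
      |measureToDual Ω (S t (VectorMeasure.dirac x 1)) (f n)| < ε := by
  by_contra hcon
  obtain ⟨ψ, hψ, hψ'⟩ := extraction_of_frequently_atTop (not_eventually.1 hcon)
  push Not at hψ'
  choose t ht x hx hle using hψ'
  have hcpt : IsCompact (Set.Icc (0 : ℝ≥0) t₀ ×ˢ K) := isCompact_Icc.prod hK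
  obtain ⟨⟨s, y⟩, ⟨hs, hy⟩, θ, hθ, hlim⟩ := hcpt.isSeqCompact
    (x := fun n => (t n, x n)) fun n => ⟨⟨zero_le, ht n⟩, hx n⟩
  have hts : Tendsto (fun n => t (θ n)) atTop (𝓝 s) := (continuous_fst.tendsto _).comp hlim
  have hxy : Tendsto (fun n => x (θ n)) atTop (𝓝 y) := (continuous_snd.tendsto _).comp hlim
  obtain ⟨C, hC⟩ := hb
  obtain ⟨M, hM0, hM⟩ := hS.exists_norm_le t₀
  have hnorm : ∀ r ≤ t₀, ∀ z, ‖S r (VectorMeasure.dirac z 1)‖ ≤ M := fun r hr z => by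
    refine ((S r).le_opNorm _).trans ?_
    rw [norm_dirac_one, mul_one]
    exact hM r hr
  set ν := S s (VectorMeasure.dirac y 1) with hν
  have hfν : Tendsto (fun n => measureToDual Ω ν (f n)) atTop (𝓝 0) := by
    have h0 : measureToDual Ω ν 0 = 0 := map_zero _
    rw [← h0]
    simp only [measureToDual_apply]
    refine VectorMeasure.tendsto_integral_filter_of_norm_le_const
      (Eventually.of_forall fun n => (f n).continuous.measurable.aestronglyMeasurable)
      ⟨C, Eventually.of_forall fun n => Eventually.of_forall fun z =>
        ((f n).norm_coe_le_norm z).trans (hC n)⟩ (Eventually.of_forall fun z => ?_)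
    exact (tendsto_compactOpenTopology_iff.1 hf {z} isCompact_singleton).tendsto_at rfl
  have hev := (hfν.comp (hψ.comp hθ).tendsto_atTop).abs
  rw [abs_zero] at hev
  obtain ⟨N, hN⟩ := eventually_atTop.1 (hev.eventually (Iio_mem_nhds (half_pos hε)))
  -- The shift by `N` ensures that the index found already has its `ν`-integral below `ε / 2`.
  obtain ⟨n, hn⟩ := exists_abs_measureToDual_lt
    (fun n => S (t (θ (n + N))) (VectorMeasure.dirac (x (θ (n + N))) 1) - ν)
    (fun n => f (ψ (θ (n + N)))) (M := M + M) (C := C) (ε := ε / 2)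
    (fun n => (norm_sub_le _ _).trans (add_le_add (hnorm _ (ht _) _) (hnorm _ hs.2 _)))
    (fun n => hC _)
    (fun g => by
      simp only [map_sub, sub_apply]
      have h := (tendsto_measureToDual_dirac hS hts hxy g).comp (tendsto_add_atTop_nat N)
      simpa [hν] using h.sub_const (measureToDual Ω ν g))
    (fun δ hδ z => by
      obtain ⟨V, hV, hVn⟩ := exists_nhds_eventually_abs_lt hf hδ z
      exact ⟨V, hV, ((hψ.comp hθ).tendsto_atTop.comp (tendsto_add_atTop_nat N)).eventually hVn⟩)
    (half_pos hε)
  rw [map_sub, sub_apply] at hn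
  have h1 := hle (θ (n + N))
  have h2 := hN (n + N) (Nat.le_add_left _ _)
  have h3 := abs_sub_abs_le_abs_sub
    (measureToDual Ω (S (t (θ (n + N))) (VectorMeasure.dirac (x (θ (n + N))) 1))
      (f (ψ (θ (n + N))))) (measureToDual Ω ν (f (ψ (θ (n + N)))))
  simp only [Function.comp_apply] at h2
  linarith

end Semigroup

theorem theorem3p6 {Ω : Type*} [TopologicalSpace Ω] [PolishSpace Ω] [MeasurableSpace Ω]
    [BorelSpace Ω] (S : ℝ≥0 → SignedMeasure Ω →L[ℝ] SignedMeasure Ω)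
    (hS : IsBicontinuousSemigroup S (weakMeasureTopology Ω)) :
    ∃ T : ℝ≥0 → (Ω →ᵇ ℝ) →L[ℝ] (Ω →ᵇ ℝ),
      IsBicontinuousSemigroup T (compactOpenTopology Ω) ∧
      (∀ (t : ℝ≥0) (μ : SignedMeasure Ω),
        (measureToDual Ω μ).comp (T t) = measureToDual Ω (S t μ)) ∧
      (∀ (t : ℝ≥0) (f : Ω →ᵇ ℝ) (x : Ω),
        T t f x = ∫ᵛ y, f y ∂•(S t (VectorMeasure.dirac x 1))) := by
  have hcont : ∀ t (f : Ω →ᵇ ℝ),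
      Continuous fun x => measureToDual Ω (S t (VectorMeasure.dirac x 1)) f := fun t f =>
    Continuous.comp
      (g := fun p : ℝ≥0 × Ω => measureToDual Ω (S p.1 (VectorMeasure.dirac p.2 1)) f)
      (f := fun x => (t, x)) (continuous_measureToDual_dirac hS f) (by fun_prop)
  have hdual : ∀ t (f : Ω →ᵇ ℝ) μ,
      measureToDual Ω μ (preadjoint (S t) (hcont t) f) = measureToDual Ω (S t μ) f :=
    fun t f μ => measureToDual_apply_eq_of_dirac hS t f _
      (preadjoint_apply (S t) (hcont t) f) μ
  refine ⟨fun t => preadjoint (S t) (hcont t), ?_, fun t μ => ?_,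
    fun t f x => preadjoint_apply (S t) (hcont t) f x⟩
  · refine { zero := ?_, add := fun s t => ?_, orbit_continuous := fun f => ?_,
             norm_bounded := ?_, locally_biequicontinuous := fun f hb hf t₀ U hU => ?_ }
    · ext f x
      rw [preadjoint_apply, hS.zero]
      exact measureToDual_dirac x f
    · ext f x
      -- Duality reverses the order of composition; commutativity of time restores it.
      rw [ContinuousLinearMap.comp_apply, preadjoint_apply, preadjoint_apply, hdual, add_comm,
        hS.add]
      rfl
    -- Currying turns joint continuity in `(t, x)` into continuity for the compact-open topology.
    · exact continuous_induced_rng.2 (ContinuousMap.continuous_of_continuous_uncurry _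
        (continuous_measureToDual_dirac hS f))
    · obtain ⟨M, hM⟩ := hS.norm_bounded
      exact ⟨M, fun t ht => (norm_preadjoint_le _ _).trans (hM t ht)⟩
    · obtain ⟨K, hK, ε, hε, hKU⟩ := exists_isCompact_of_mem_nhds_compactOpenTopology hU
      filter_upwards [eventually_abs_measureToDual_dirac_lt hS hb hf t₀ hK hε] with n hn t ht
      exact hKU _ fun x hx => hn t ht x hx
  · ext f
    exact hdual t f μ
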